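/- Let $d\ge 1$, let $\Omega\subset\mathbb R^d$ be a bounded open set, and let $A:\Omega\to\mathbb R^{d\times d}$ be measurable and symmetric with $|\xi|^2\le A(x)\xi\cdot\xi\le a_{\max}|\xi|^2$ for all $x\in\Omega$, $\xi\in\mathbb R^d$ and some constant $a_{\max}$. Let $\mathbf b\in L^\infty(\Omega)^d$, $c\in L^\infty(\Omega)$ and $c=c^++c^-$ with $c^+\in L^\infty(\Omega)$, $c^+\ge 0$. For open $\Omega'\subset\Omega$ put $$a_{\Omega'}(u,v)=\int_{\Omega'}\big(A\nabla u\cdot\nabla v+c^+uv\big)\,dx,\qquad b_{\Omega'}(u,v)=\int_{\Omega'}\big(A\nabla u\cdot\nabla v+(\mathbf b\cdot\nabla u)\,v+cuv\big)\,dx,\qquad \|u\|_{a,\Omega'}=a_{\Omega'}(u,u)^{1/2},$$ and write $b=b_\Omega$. Let $$C_0(\mathbf b,c^-)=\Big(\tfrac12\|\mathbf b\|_{\infty}^2+\max\{-\operatorname{ess\,inf}_\Omega c^-,0\}\Big)^{1/2},\qquad \|\mathbf b\|_\infty=\operatorname{ess\,sup}_{\Omega}|\mathbf b(x)|\ \ (\text{Euclidean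 norm}).$$ Let $V^h\subset H^1_0(\Omega)$ be a finite-dimensional subspace (for instance any conforming finite element space), and let $\Omega_1,\dots,\Omega_N\subset\Omega$ be open (for instance the subdomains of an overlapping decomposition of $\Omega$ into unions of mesh elements), with $H=\max_i\operatorname{diam}\Omega_i$. Put $V_i=\{v|_{\Omega_i}: v\in V^h\}\cap H^1_0(\Omega_i)$ and let $R_i^\top v$ denote the extension of $v\in V_i$ by zero to $\Omega$. If $H\,C_0(\mathbf b,c^-)<1/4$, then for every $u\in V^h$ and every $i\in\{1,\dots,N\}$ there is a unique $T_iu\in V_i$ with $$b_{\Omega_i}(T_iu,v)=b(u,R_i^\top v)\qquad\text{for all }v\in V_i,$$ and it satisfies $$\|T_iu\|_{a,\Omega_i}\le 2\sqrt2\,\|u\|_{a,\Omega_i}+2\sqrt{\tfrac23}\;H\,\|c^-\|_{L^\infty(\Omega_i)}\,\|u\|_{L^2(\Omega_i)}.$$ -/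

import Mathlib

open MeasureTheory TopologicalSpace
open scoped ContDiff Matrix

noncomputable section

namespace Schwarz

/-- Euclidean space of dimension `d`. -/
abbrev E (d : ℕ) : Type := EuclideanSpace ℝ (Fin d)

/-- Lebesgue measure on the open set `Ω`. -/
abbrev vol {d : ℕ} (Ω : Opens (E d)) : Measure (E d) := volume.restrict (Ω : Set (E d))

/-- Pairs `(u, g)` in `L²(Ω) × L²(Ω; ℝᵈ)`.  An `H¹` function is represented by the pair `(u, ∇u)`,
so that `p.1` is the function and `p.2` its weak gradient. -/
abbrev Pair {d : ℕ} (Ω : Opens (E d)) : Type := Lp ℝ 2 (vol Ω) × Lp (E d) 2 (vol Ω)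

/-- Test functions on `Ω`: smooth with compact support contained in `Ω`. -/
structure IsTest {d : ℕ} (Ω : Opens (E d)) (φ : E d → ℝ) : Prop where
  smooth : ContDiff ℝ ∞ φ
  compact : HasCompactSupport φ
  support : tsupport φ ⊆ Ω

theorem IsTest.memLp {d : ℕ} {Ω : Opens (E d)} {φ : E d → ℝ} (h : IsTest Ω φ) :
    MemLp φ 2 (vol Ω) :=
  (h.smooth.continuous.memLp_of_hasCompactSupport h.compact (μ := volume)).mono_measure
    Measure.restrict_le_self

theorem IsTest.memLp_partial {d : ℕ} {Ω : Opens (E d)} {φ : E d → ℝ} (h : IsTest Ω φ) (v : E d) :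
    MemLp (fun x => fderiv ℝ φ x v) 2 (vol Ω) := by
  have hc : Continuous (fun x => fderiv ℝ φ x v) :=
    (h.smooth.continuous_fderiv (by simp)).clm_apply continuous_const
  have hs : HasCompactSupport (fun x => fderiv ℝ φ x v) :=
    h.compact.fderiv_apply ℝ v
  exact (hc.memLp_of_hasCompactSupport hs (μ := volume)).mono_measure Measure.restrict_le_self

theorem memLp_coord {d : ℕ} {μ : Measure (E d)} (g : Lp (E d) 2 μ) (i : Fin d) :
    MemLp (fun x => g x i) 2 μ :=
  (EuclideanSpace.proj i : E d →L[ℝ] ℝ).comp_memLp' (Lp.memLp g)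

/-- The Sobolev space `H¹(Ω)`: all pairs `(u, g)` for which `g` is the weak gradient of `u`. -/
def H1 {d : ℕ} (Ω : Opens (E d)) : Submodule ℝ (Pair Ω) where
  carrier := {p | ∀ φ : E d → ℝ, IsTest Ω φ → ∀ i : Fin d,
    ∫ x in (Ω : Set (E d)), p.1 x * fderiv ℝ φ x (EuclideanSpace.single i 1)
      = - ∫ x in (Ω : Set (E d)), p.2 x i * φ x}
  zero_mem' := by
    intro φ _ i
    have h1 : ∫ x in (Ω : Set (E d)), (0 : Pair Ω).1 x * fderiv ℝ φ x (EuclideanSpace.single i 1)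
        = 0 := by
      refine integral_eq_zero_of_ae ?_
      filter_upwards [Lp.coeFn_zero ℝ 2 (vol Ω)] with x hx
      simp only [Prod.fst_zero, hx, Pi.zero_apply, zero_mul]
    have h2 : ∫ x in (Ω : Set (E d)), (0 : Pair Ω).2 x i * φ x = 0 := by
      refine integral_eq_zero_of_ae ?_
      filter_upwards [Lp.coeFn_zero (E d) 2 (vol Ω)] with x hx
      simp only [Prod.snd_zero, hx, Pi.zero_apply, PiLp.zero_apply, zero_mul]
    rw [h1, h2, neg_zero]
  add_mem' := by
    intro p q hp hq φ hφ i
    have e1 : ∫ x in (Ω : Set (E d)), (p + q).1 x * fderiv ℝ φ x (EuclideanSpace.single i 1)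
        = (∫ x in (Ω : Set (E d)), p.1 x * fderiv ℝ φ x (EuclideanSpace.single i 1))
          + ∫ x in (Ω : Set (E d)), q.1 x * fderiv ℝ φ x (EuclideanSpace.single i 1) := by
      refine Eq.trans (integral_congr_ae ?_)
        (integral_add ((Lp.memLp p.1).integrable_mul (hφ.memLp_partial _))
          ((Lp.memLp q.1).integrable_mul (hφ.memLp_partial _)))
      filter_upwards [Lp.coeFn_add p.1 q.1] with x hx
      simp only [Prod.fst_add, hx, Pi.add_apply, add_mul]
    have e2 : ∫ x in (Ω : Set (E d)), (p + q).2 x i * φ x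
        = (∫ x in (Ω : Set (E d)), p.2 x i * φ x) + ∫ x in (Ω : Set (E d)), q.2 x i * φ x := by
      refine Eq.trans (integral_congr_ae ?_)
        (integral_add ((memLp_coord p.2 i).integrable_mul hφ.memLp)
          ((memLp_coord q.2 i).integrable_mul hφ.memLp))
      filter_upwards [Lp.coeFn_add p.2 q.2] with x hx
      simp only [Prod.snd_add, hx, Pi.add_apply, PiLp.add_apply, add_mul]
    rw [e1, e2, hp φ hφ i, hq φ hφ i, neg_add]
  smul_mem' := by
    intro r p hp φ hφ i
    have e1 : ∫ x in (Ω : Set (E d)), (r • p).1 x * fderiv ℝ φ x (EuclideanSpace.single i 1)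
        = r * ∫ x in (Ω : Set (E d)), p.1 x * fderiv ℝ φ x (EuclideanSpace.single i 1) := by
      rw [← integral_const_mul]
      refine integral_congr_ae ?_
      filter_upwards [Lp.coeFn_smul r p.1] with x hx
      simp only [Prod.smul_fst, hx, Pi.smul_apply, smul_eq_mul, mul_assoc]
    have e2 : ∫ x in (Ω : Set (E d)), (r • p).2 x i * φ x
        = r * ∫ x in (Ω : Set (E d)), p.2 x i * φ x := by
      rw [← integral_const_mul]
      refine integral_congr_ae ?_
      filter_upwards [Lp.coeFn_smul r p.2] with x hx
      simp only [Prod.smul_snd, hx, Pi.smul_apply, PiLp.smul_apply, smul_eq_mul, mul_assoc]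
    rw [e1, e2, hp φ hφ i, mul_neg]

/-- The pairs `(φ, ∇φ)` of test functions `φ` on `Ω`. -/
def testPairs {d : ℕ} (Ω : Opens (E d)) : Set (Pair Ω) :=
  {p | ∃ φ : E d → ℝ, IsTest Ω φ ∧ p.1 =ᵐ[vol Ω] φ ∧ p.2 =ᵐ[vol Ω] gradient φ}

/-- The Sobolev space `H¹₀(Ω)`: the closure of the test functions in `H¹(Ω)`.  (The test pairs
already form a linear subspace, and the product topology of `L² × L²` induces the usual topology
of `H¹`.) -/
def H10 {d : ℕ} (Ω : Opens (E d)) : Submodule ℝ (Pair Ω) :=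
  H1 Ω ⊓ (Submodule.span ℝ (testPairs Ω)).topologicalClosure

/-- Restriction of `L²` functions from `Ω` to the open subset `Ω'`. -/
def restrictLp {d : ℕ} (F : Type) [NormedAddCommGroup F] [NormedSpace ℝ F] {Ω' Ω : Opens (E d)}
    (h : Ω' ≤ Ω) : Lp F 2 (vol Ω) →ₗ[ℝ] Lp F 2 (vol Ω') where
  toFun f := ((Lp.memLp f).mono_measure (Measure.restrict_mono_set volume h)).toLp
  map_add' f g := by
    rw [← MemLp.toLp_add]
    refine MemLp.toLp_congr _ _ ?_
    exact ae_mono (Measure.restrict_mono_set volume h) (Lp.coeFn_add f g)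
  map_smul' r f := by
    rw [RingHom.id_apply, ← MemLp.toLp_const_smul]
    refine MemLp.toLp_congr _ _ ?_
    exact ae_mono (Measure.restrict_mono_set volume h) (Lp.coeFn_smul r f)

/-- Restriction `v ↦ v|_{Ω'}` of a function together with its weak gradient. -/
def restrict {d : ℕ} {Ω' Ω : Opens (E d)} (h : Ω' ≤ Ω) : Pair Ω →ₗ[ℝ] Pair Ω' :=
  (restrictLp ℝ h).prodMap (restrictLp (E d) h)

theorem memLp_indicator {d : ℕ} {F : Type} [NormedAddCommGroup F] {Ω' Ω : Opens (E d)}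
    (h : Ω' ≤ Ω) (f : Lp F 2 (vol Ω')) :
    MemLp ((Ω' : Set (E d)).indicator f) 2 (vol Ω) := by
  rw [memLp_indicator_iff_restrict Ω'.isOpen.measurableSet,
    Measure.restrict_restrict Ω'.isOpen.measurableSet,
    Set.inter_eq_left.mpr (show (Ω' : Set (E d)) ⊆ Ω from h)]
  exact Lp.memLp f

/-- Zero extension `Rᵀ` from `Ω'` to `Ω` of a function and its gradient; on `H¹₀(Ω')` this is the
pair of the zero extension and its weak gradient. -/
def zeroExt {d : ℕ} {Ω' Ω : Opens (E d)} (h : Ω' ≤ Ω) (p : Pair Ω') : Pair Ω :=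
  ((memLp_indicator h p.1).toLp, (memLp_indicator h p.2).toLp)

/-- `a_Ω(u,v) = ∫_Ω (A ∇u · ∇v + c⁺ u v) dx`. -/
def aForm {d : ℕ} (A : E d → Matrix (Fin d) (Fin d) ℝ) (cp : E d → ℝ)
    (Ω : Opens (E d)) (u v : Pair Ω) : ℝ :=
  ∫ x in (Ω : Set (E d)),
    ((A x *ᵥ (u.2 x).ofLp) ⬝ᵥ (v.2 x).ofLp + cp x * u.1 x * v.1 x)

/-- `b_Ω(u,v) = ∫_Ω (A ∇u · ∇v + (b · ∇u) v + c u v) dx`. -/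
def bForm {d : ℕ} (A : E d → Matrix (Fin d) (Fin d) ℝ) (b : E d → E d) (c : E d → ℝ)
    (Ω : Opens (E d)) (u v : Pair Ω) : ℝ :=
  ∫ x in (Ω : Set (E d)),
    ((A x *ᵥ (u.2 x).ofLp) ⬝ᵥ (v.2 x).ofLp + inner ℝ (b x) (u.2 x) * v.1 x + c x * u.1 x * v.1 x)

/-- The energy norm `‖u‖_{a,Ω} = a_Ω(u,u)^{1/2}`. -/
def aNorm {d : ℕ} (A : E d → Matrix (Fin d) (Fin d) ℝ) (cp : E d → ℝ)
    (Ω : Opens (E d)) (u : Pair Ω) : ℝ :=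
  Real.sqrt (aForm A cp Ω u u)

/-- The norm of `L^∞(Ω)`; for vector fields it is the essential supremum of the Euclidean norm. -/
def linfNorm {d : ℕ} {F : Type} [NormedAddCommGroup F] (Ω : Opens (E d)) (f : E d → F) : ℝ :=
  (eLpNorm f ⊤ (vol Ω)).toReal

/-- `C₀(b, c⁻) = (½ ‖b‖²_∞ + max {- essinf c⁻, 0})^{1/2}`. -/
def C0 {d : ℕ} (Ω : Opens (E d)) (b : E d → E d) (cm : E d → ℝ) : ℝ :=
  Real.sqrt (1 / 2 * linfNorm Ω b ^ 2 + max (-(essInf cm (vol Ω))) 0)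

/-- The standing assumptions on the coefficients `A`, `b`, `c` and on the part `c⁺` of `c`. The
lower ellipticity constant is normalised to `1`. -/
structure Admissible {d : ℕ} (Ω : Opens (E d)) (A : E d → Matrix (Fin d) (Fin d) ℝ)
    (b : E d → E d) (c cp : E d → ℝ) : Prop where
  A_meas : ∀ i j, AEStronglyMeasurable (fun x => A x i j) (vol Ω)
  A_symm : ∀ x ∈ Ω, (A x).IsSymm
  A_bounds : ∃ amax : ℝ, ∀ x ∈ Ω, ∀ ξ : E d,
    ‖ξ‖ ^ 2 ≤ (A x *ᵥ ξ.ofLp) ⬝ᵥ ξ.ofLp ∧ (A x *ᵥ ξ.ofLp) ⬝ᵥ ξ.ofLp ≤ amax * ‖ξ‖ ^ 2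
  b_mem : MemLp b ⊤ (vol Ω)
  c_mem : MemLp c ⊤ (vol Ω)
  cp_mem : MemLp cp ⊤ (vol Ω)
  cp_nonneg : ∀ x ∈ Ω, 0 ≤ cp x

/-- The local space `V_i`: restrictions to `Ω'` of functions of `V`, with zero boundary values. -/
def localSpace {d : ℕ} {Ω' Ω : Opens (E d)} (h : Ω' ≤ Ω) (V : Submodule ℝ (Pair Ω)) :
    Submodule ℝ (Pair Ω') :=
  V.map (restrict h) ⊓ H10 Ω'

/-- `w = T u`, where `T : V → localSpace` is the projection onto the local space of the subdomain
`Ω'`, defined by `b_{Ω'}(T u, v) = b_Ω(u, Rᵀ v)` for all `v` in the local space. -/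
def IsLocalProj {d : ℕ} (A : E d → Matrix (Fin d) (Fin d) ℝ) (b : E d → E d) (c : E d → ℝ)
    {Ω' Ω : Opens (E d)} (h : Ω' ≤ Ω) (V : Submodule ℝ (Pair Ω)) (u : Pair Ω) (w : Pair Ω') :
    Prop :=
  w ∈ localSpace h V ∧ ∀ v ∈ localSpace h V, bForm A b c Ω' w v = bForm A b c Ω u (zeroExt h v)

end Schwarz

end

noncomputable section

namespace Schwarz

/-! Smallness of the subdomains makes the indefinite form coercive on them. On `H10` of a set of
diameter at most `H` the Friedrichs inequality holds with constant `H ^ 2 / 2`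
(`norm_sq_le_of_mem_H10`). The Gårding inequality (`garding`) bounds `b(v,v)` below by half the
energy minus `C0 ^ 2 * ‖v‖ ^ 2`. Since `H * C0 < 1/4`, the loss is at most 1/32 of the energy, so
`b` is coercive with constant 15/32 (`coercive`). In the finite-dimensional local space this gives
injectivity, hence unique solvability.

For stability, test with `w = T u`. The right-hand side only sees the restriction of `u` to the
subdomain (`bForm_zeroExt`), and `bForm_le` bounds it by energy norms and `‖w‖`. Friedrichs turns
`‖w‖` into `H` times the energy norm of `w`, one factor of which then cancels. The restriction of
`u` need not vanish on the boundary, so Friedrichs does not apply to it and its `L²` norm remains in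
the bound. -/

/-! ### The Friedrichs inequality on `H¹₀` with an explicit constant. -/

/-- A polynomial subsolution of a Riccati equation, which yields the Friedrichs inequality. -/
theorem two_div_sq_le_riccati {L t : ℝ} (hL : 0 < L) (ht : |t| ≤ L / 2) :
    2 / L ^ 2 ≤ (2 / L ^ 2 + 15 / 2 * t ^ 2 / L ^ 4)
      - (2 * t / L ^ 2 + 5 / 2 * t ^ 3 / L ^ 4) ^ 2 := by
  have hu : (t / L) ^ 2 ≤ 1 / 4 := by
    rw [div_pow, div_le_iff₀ (by positivity), ← sq_abs]
    nlinarith [abs_nonneg t]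
  set s := t / L with hs
  have hts : t = s * L := by rw [hs]; field_simp
  have key : (2 / L ^ 2 + 15 / 2 * t ^ 2 / L ^ 4) - (2 * t / L ^ 2 + 5 / 2 * t ^ 3 / L ^ 4) ^ 2
      - 2 / L ^ 2 = s ^ 2 * (15 / 2 - (2 + 5 / 2 * s ^ 2) ^ 2) / L ^ 2 := by
    rw [hts]; field_simp; ring
  have : 0 ≤ s ^ 2 * (15 / 2 - (2 + 5 / 2 * s ^ 2) ^ 2) / L ^ 2 := by
    -- At the edge `s ^ 2 = 1/4` the square is `(21/8) ^ 2 = 441/64`, below 15/2.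
    have : 0 ≤ 15 / 2 - (2 + 5 / 2 * s ^ 2) ^ 2 := by nlinarith [sq_nonneg s]
    positivity
  linarith

/-- The Friedrichs inequality for test functions on a set contained in a slab of width `L`. -/
theorem IsTest.integral_sq_le {d : ℕ} {Ω : Opens (E d)} {φ : E d → ℝ} (h : IsTest Ω φ)
    (i : Fin d) {m L : ℝ} (hL : 0 < L) (hm : ∀ x ∈ Ω, |x i - m| ≤ L / 2) :
    ∫ x, φ x ^ 2 ≤ L ^ 2 / 2 * ∫ x, fderiv ℝ φ x (EuclideanSpace.single i 1) ^ 2 := by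
  set e : E d := EuclideanSpace.single i 1
  -- The exact solution of `F' - F ^ 2 = 2 / L ^ 2` is a scaled tangent. This cubic has the same
  -- linear term and a cubic coefficient raised from 4/3 to 5/2 to absorb the remainder; unlike the
  -- tangent it is smooth on the whole space.
  set F : E d → ℝ := fun x => 2 * (x i - m) / L ^ 2 + 5 / 2 * (x i - m) ^ 3 / L ^ 4 with hF
  set F' : E d → ℝ := fun x => 2 / L ^ 2 + 15 / 2 * (x i - m) ^ 2 / L ^ 4 with hF'
  have hcoord : ContDiff ℝ ∞ (fun x : E d => x i) :=
    (EuclideanSpace.proj i : E d →L[ℝ] ℝ).contDiff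
  have hFs : ContDiff ℝ ∞ F := by fun_prop
  have hF'c : Continuous F' := by
    have := hcoord.continuous
    fun_prop
  have hFd : ∀ x, fderiv ℝ F x e = F' x := by
    intro x
    have h1 : HasFDerivAt (fun x : E d => x i - m) (EuclideanSpace.proj i : E d →L[ℝ] ℝ) x :=
      (EuclideanSpace.proj i : E d →L[ℝ] ℝ).hasFDerivAt.sub_const m
    have h2 : HasDerivAt (fun t : ℝ => 2 * t / L ^ 2 + 5 / 2 * t ^ 3 / L ^ 4)
        (2 * 1 / L ^ 2 + 5 / 2 * ((3 : ℕ) * (x i - m) ^ 2 * 1) / L ^ 4) (x i - m) :=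
      (((hasDerivAt_id _).const_mul 2).div_const _).add
        ((((hasDerivAt_id _).pow 3).const_mul (5 / 2)).div_const _)
    have h3 := h2.comp_hasFDerivAt x h1
    rw [show F = (fun t : ℝ => 2 * t / L ^ 2 + 5 / 2 * t ^ 3 / L ^ 4) ∘ (fun x : E d => x i - m)
      from rfl, h3.fderiv]
    simp [e, hF']
    ring
  have hφc := h.smooth.continuous
  have hφd : Differentiable ℝ φ := h.smooth.differentiable (by simp)
  set D : E d → ℝ := fun x => fderiv ℝ φ x e with hD
  have hDc : Continuous D := (h.smooth.continuous_fderiv (by simp)).clm_apply continuous_const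
  have hDs : HasCompactSupport D := h.compact.fderiv_apply ℝ e
  have hsqd : ∀ x, fderiv ℝ (fun y => φ y ^ 2) x e = 2 * φ x * D x := by
    intro x
    rw [((hφd x).hasFDerivAt.pow 2).fderiv]
    simp [hD]
  have hsq : HasCompactSupport (fun x => φ x ^ 2) := by
    simp only [sq]
    exact h.compact.mul_left (f := φ)
  have i1 : Integrable (fun x => φ x ^ 2) := (hφc.pow 2).integrable_of_hasCompactSupport hsq
  have i2 : Integrable (fun x => D x ^ 2) :=
    (hDc.pow 2).integrable_of_hasCompactSupport (by
      simp only [sq]; exact hDs.mul_left (f := D))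
  have i3 : Integrable (fun x => F' x * φ x ^ 2) :=
    (hF'c.mul (hφc.pow 2)).integrable_of_hasCompactSupport hsq.mul_left
  have i4 : Integrable (fun x => F x * (2 * φ x * D x)) :=
    (hFs.continuous.mul ((continuous_const.mul hφc).mul hDc)).integrable_of_hasCompactSupport
      (hDs.mul_left.mul_left)
  have i5 : Integrable (fun x => F x * φ x ^ 2) :=
    (hFs.continuous.mul (hφc.pow 2)).integrable_of_hasCompactSupport hsq.mul_left
  have ibp : ∫ x, F x * (2 * φ x * D x) = - ∫ x, F' x * φ x ^ 2 := by
    have := integral_mul_fderiv_eq_neg_fderiv_mul_of_integrable (μ := volume) (𝕜 := ℝ)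
      (f := F) (g := fun y => φ y ^ 2) (v := e) (by simpa only [hFd] using i3)
      (by simpa only [hsqd] using i4) i5 (fun x _ => hFs.differentiable (by simp) x)
      (fun x _ => (hφd.pow 2) x)
    simpa only [hFd, hsqd] using this
  -- Expand `(D + F * φ) ^ 2 ≥ 0` and use `F' - F ^ 2 ≥ 2 / L ^ 2` on the slab. After integration
  -- the two middle terms cancel by `ibp`.
  have hpt : ∀ x, 2 / L ^ 2 * φ x ^ 2 ≤ F' x * φ x ^ 2 + F x * (2 * φ x * D x) + D x ^ 2 := by
    intro x
    by_cases hx : x ∈ Ω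
    · have := mul_le_mul_of_nonneg_right (two_div_sq_le_riccati hL (hm x hx)) (sq_nonneg (φ x))
      have h2 : (2 / L ^ 2 + 15 / 2 * (x i - m) ^ 2 / L ^ 4 - F x ^ 2) * φ x ^ 2
        = F' x * φ x ^ 2 - F x ^ 2 * φ x ^ 2 := by rw [hF']; ring
      have h3 := sq_nonneg (D x + F x * φ x)
      nlinarith
    · have : φ x = 0 := by
        by_contra h0
        exact hx (h.support (subset_tsupport φ h0))
      simp [this, sq_nonneg]
  have hint := integral_mono (i1.const_mul (2 / L ^ 2)) ((i3.add i4).add i2) hpt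
  have hsum := integral_add (i3.add i4) i2
  simp only [Pi.add_apply] at hsum hint
  rw [integral_const_mul, hsum, integral_add i3 i4, ibp, add_neg_cancel, zero_add] at hint
  have : ∫ x, φ x ^ 2 = L ^ 2 / 2 * (2 / L ^ 2 * ∫ x, φ x ^ 2) := by field_simp
  rw [this]
  exact mul_le_mul_of_nonneg_left hint (by positivity)

theorem norm_sq_eq_integral {d : ℕ} {F : Type} [NormedAddCommGroup F] [InnerProductSpace ℝ F]
    {μ : Measure (E d)} (f : Lp F 2 μ) : ‖f‖ ^ 2 = ∫ x, ‖f x‖ ^ 2 ∂μ := by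
  rw [← real_inner_self_eq_norm_sq, L2.inner_def]
  simp only [real_inner_self_eq_norm_sq]

/-- A bounded set of diameter at most `L` lies in a slab of width `L`. -/
theorem exists_abs_coord_sub_le {d : ℕ} {S : Set (E d)} (hS : Bornology.IsBounded S) (i : Fin d)
    {L : ℝ} (hL : Metric.diam S ≤ L) : ∃ m : ℝ, ∀ x ∈ S, |x i - m| ≤ L / 2 := by
  set T : Set ℝ := (fun x : E d => x i) '' S
  have hlip : LipschitzWith 1 (fun x : E d => x i) := by
    refine LipschitzWith.of_dist_le_mul fun x y => ?_
    rw [NNReal.coe_one, one_mul, dist_eq_norm, dist_eq_norm]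
    exact PiLp.norm_apply_le (x - y) i
  have hT : Bornology.IsBounded T := hlip.isBounded_image hS
  have hdiam : sSup T - sInf T ≤ L := by
    rw [← Real.diam_eq hT]
    refine le_trans ?_ hL
    simpa using hlip.diam_image_le S hS
  refine ⟨(sSup T + sInf T) / 2, fun x hx => ?_⟩
  have h1 : x i ≤ sSup T := le_csSup hT.bddAbove ⟨x, hx, rfl⟩
  have h2 : sInf T ≤ x i := csInf_le hT.bddBelow ⟨x, hx, rfl⟩
  rw [abs_le]
  constructor <;> linarith

theorem IsTest.add {d : ℕ} {Ω : Opens (E d)} {φ ψ : E d → ℝ} (h : IsTest Ω φ) (h' : IsTest Ω ψ) :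
    IsTest Ω (φ + ψ) where
  smooth := h.smooth.add h'.smooth
  compact := h.compact.add h'.compact
  support := (tsupport_add φ ψ).trans (Set.union_subset h.support h'.support)

theorem IsTest.const_smul {d : ℕ} {Ω : Opens (E d)} {φ : E d → ℝ} (h : IsTest Ω φ) (r : ℝ) :
    IsTest Ω (r • φ) where
  smooth := h.smooth.const_smul r
  compact := h.compact.smul_left (f := fun _ => r)
  support := (tsupport_smul_subset_right (fun _ => r) φ).trans h.support

/-- The test pairs form a linear subspace. -/
theorem mem_testPairs_of_mem_span {d : ℕ} {Ω : Opens (E d)} {p : Pair Ω}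
    (hp : p ∈ Submodule.span ℝ (testPairs Ω)) : p ∈ testPairs Ω := by
  have hd : ∀ {φ : E d → ℝ}, IsTest Ω φ → Differentiable ℝ φ := fun {φ} h =>
    h.smooth.differentiable (by simp)
  induction hp using Submodule.span_induction with
  | mem x h => exact h
  | zero =>
    refine ⟨0, ⟨contDiff_const, HasCompactSupport.zero, by simp [tsupport]⟩, Lp.coeFn_zero _ _ _, ?_⟩
    filter_upwards [Lp.coeFn_zero (E d) 2 (vol Ω)] with x hx
    simp only [Prod.snd_zero, hx, gradient]
    simp
  | add p q _ _ hp hq =>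
    obtain ⟨φ, hφ, hφ1, hφ2⟩ := hp
    obtain ⟨ψ, hψ, hψ1, hψ2⟩ := hq
    refine ⟨φ + ψ, hφ.add hψ, (Lp.coeFn_add _ _).trans (hφ1.add hψ1), ?_⟩
    filter_upwards [Lp.coeFn_add p.2 q.2, hφ2, hψ2] with x hx h1 h2
    rw [Prod.snd_add, hx, Pi.add_apply, h1, h2, gradient, gradient, gradient,
      fderiv_add (hd hφ x) (hd hψ x), map_add]
  | smul r p _ hp =>
    obtain ⟨φ, hφ, hφ1, hφ2⟩ := hp
    refine ⟨r • φ, hφ.const_smul r, (Lp.coeFn_smul _ _).trans (hφ1.const_smul r), ?_⟩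
    filter_upwards [Lp.coeFn_smul r p.2, hφ2] with x hx h1
    rw [Prod.smul_snd, hx, Pi.smul_apply, h1, gradient, gradient,
      fderiv_const_smul (hd hφ x), map_smulₛₗ]
    simp

/-- The Friedrichs inequality for pairs of test functions. -/
theorem norm_sq_le_of_mem_testPairs {d : ℕ} (i : Fin d) {Ω : Opens (E d)} {m L : ℝ} (hL : 0 < L)
    (hm : ∀ x ∈ Ω, |x i - m| ≤ L / 2) {p : Pair Ω} (hp : p ∈ testPairs Ω) :
    ‖p.1‖ ^ 2 ≤ L ^ 2 / 2 * ‖p.2‖ ^ 2 := by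
  obtain ⟨φ, hφ, h1, h2⟩ := hp
  have hzero : ∀ x ∉ (Ω : Set (E d)), x ∉ tsupport φ := fun x hx h => hx (hφ.support h)
  have e1 : ‖p.1‖ ^ 2 = ∫ x, φ x ^ 2 := by
    rw [norm_sq_eq_integral, ← setIntegral_eq_integral_of_forall_compl_eq_zero
      (f := fun x => φ x ^ 2) (s := (Ω : Set (E d))) fun x hx => ?_]
    · refine integral_congr_ae ?_
      filter_upwards [h1] with x hx
      rw [hx, Real.norm_eq_abs, sq_abs]
    · rw [image_eq_zero_of_notMem_tsupport (hzero x hx), zero_pow two_ne_zero]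
  have e2 : ∫ x, fderiv ℝ φ x (EuclideanSpace.single i 1) ^ 2 ≤ ‖p.2‖ ^ 2 := by
    rw [norm_sq_eq_integral, ← setIntegral_eq_integral_of_forall_compl_eq_zero
      (f := fun x => fderiv ℝ φ x (EuclideanSpace.single i 1) ^ 2)
      (s := (Ω : Set (E d))) fun x hx => ?_]
    · refine integral_mono_ae (hφ.memLp_partial _).integrable_sq
        ((Lp.memLp p.2).integrable_norm_pow two_ne_zero) ?_
      filter_upwards [h2] with x hx
      rw [hx, gradient, LinearIsometryEquiv.norm_map, ← sq_abs, ← Real.norm_eq_abs]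
      gcongr
      refine ((fderiv ℝ φ x).le_opNorm _).trans ?_
      simp
    · rw [fderiv_of_notMem_tsupport ℝ (hzero x hx)]
      simp
  rw [e1]
  exact (hφ.integral_sq_le i hL hm).trans (mul_le_mul_of_nonneg_left e2 (by positivity))

/-- The Friedrichs inequality on `H¹₀`. -/
theorem norm_sq_le_of_mem_H10 {d : ℕ} (hd : 1 ≤ d) {Ω : Opens (E d)}
    (hb : Bornology.IsBounded (Ω : Set (E d))) {L : ℝ}
    (hdiam : Metric.diam (Ω : Set (E d)) ≤ L) {p : Pair Ω} (hp : p ∈ H10 Ω) :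
    ‖p.1‖ ^ 2 ≤ L ^ 2 / 2 * ‖p.2‖ ^ 2 := by
  have hL0 : 0 ≤ L := Metric.diam_nonneg.trans hdiam
  -- The slab estimate needs positive width, while `L` may be 0 for an empty set; hence the detour
  -- through `L' > L` and a limit.
  have key : ∀ L' : ℝ, L < L' → ‖p.1‖ ^ 2 ≤ L' ^ 2 / 2 * ‖p.2‖ ^ 2 := by
    intro L' hL'
    obtain ⟨m, hm⟩ := exists_abs_coord_sub_le hb (⟨0, hd⟩ : Fin d) (hdiam.trans hL'.le)
    have hcl : IsClosed {q : Pair Ω | ‖q.1‖ ^ 2 ≤ L' ^ 2 / 2 * ‖q.2‖ ^ 2} :=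
      isClosed_le (by fun_prop) (by fun_prop)
    exact closure_minimal (fun q hq => norm_sq_le_of_mem_testPairs _ (hL0.trans_lt hL') hm
      (mem_testPairs_of_mem_span hq)) hcl hp.2
  have hcont : Continuous fun t : ℝ => t ^ 2 / 2 * ‖p.2‖ ^ 2 := by fun_prop
  exact ge_of_tendsto (hcont.continuousWithinAt (s := Set.Ioi L) (x := L))
    (Filter.eventually_of_mem self_mem_nhdsWithin key)

/-! ### Cauchy–Schwarz, essential bounds and symmetric matrices. -/

/-- Cauchy–Schwarz is applied to the scalar functions `‖f x‖` and `‖g x‖`, so that a gradient can be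
paired with a function. -/
theorem integral_norm_mul_norm_le {d : ℕ} {F G : Type} [NormedAddCommGroup F]
    [NormedAddCommGroup G] {μ : Measure (E d)} (f : Lp F 2 μ) (g : Lp G 2 μ) :
    ∫ x, ‖f x‖ * ‖g x‖ ∂μ ≤ ‖f‖ * ‖g‖ := by
  have h := real_inner_le_norm ((Lp.memLp f).norm.toLp (fun x => ‖f x‖))
    ((Lp.memLp g).norm.toLp (fun x => ‖g x‖))
  rw [L2.inner_def, Lp.norm_toLp, Lp.norm_toLp, eLpNorm_norm, eLpNorm_norm, ← Lp.norm_def,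
    ← Lp.norm_def] at h
  refine le_of_eq_of_le (integral_congr_ae ?_) h
  filter_upwards [(Lp.memLp f).norm.coeFn_toLp, (Lp.memLp g).norm.coeFn_toLp] with x hf hg
  rw [hf, hg]
  simp [mul_comm]

theorem integrable_norm_mul_norm {d : ℕ} {F G : Type} [NormedAddCommGroup F]
    [NormedAddCommGroup G] {μ : Measure (E d)} (f : Lp F 2 μ) (g : Lp G 2 μ) :
    Integrable (fun x => ‖f x‖ * ‖g x‖) μ :=
  (Lp.memLp f).norm.integrable_mul (Lp.memLp g).norm

theorem vol_mono {d : ℕ} {Ω' Ω : Opens (E d)} (h : Ω' ≤ Ω) : vol Ω' ≤ vol Ω :=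
  Measure.restrict_mono_set volume h

theorem ae_mem {d : ℕ} (Ω : Opens (E d)) : ∀ᵐ x ∂vol Ω, x ∈ Ω :=
  ae_restrict_mem Ω.isOpen.measurableSet

theorem linfNorm_nonneg {d : ℕ} {F : Type} [NormedAddCommGroup F] (Ω : Opens (E d))
    (f : E d → F) : 0 ≤ linfNorm Ω f := ENNReal.toReal_nonneg

theorem ae_norm_le_linfNorm {d : ℕ} {F : Type} [NormedAddCommGroup F] {Ω : Opens (E d)}
    {f : E d → F} (hf : MemLp f ⊤ (vol Ω)) : ∀ᵐ x ∂vol Ω, ‖f x‖ ≤ linfNorm Ω f := by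
  filter_upwards [ae_le_eLpNormEssSup (f := f) (μ := vol Ω)] with x hx
  rw [← eLpNorm_exponent_top] at hx
  have := ENNReal.toReal_mono hf.2.ne hx
  rwa [toReal_enorm] at this

/-- A real-valued `essInf` is meaningful only for functions essentially bounded below; the `L^∞`
bound supplies this. -/
theorem ae_essInf_le_of_memLp_top {d : ℕ} {Ω : Opens (E d)} {f : E d → ℝ}
    (hf : MemLp f ⊤ (vol Ω)) : ∀ᵐ x ∂vol Ω, essInf f (vol Ω) ≤ f x := by
  refine ae_essInf_le ⟨-linfNorm Ω f, ?_⟩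
  rw [Filter.eventually_map]
  filter_upwards [ae_norm_le_linfNorm hf] with x hx
  exact (abs_le.mp hx).1

theorem mulVec_dotProduct_comm {d : ℕ} {M : Matrix (Fin d) (Fin d) ℝ} (hM : M.IsSymm) (ξ η : Fin d → ℝ) :
    (M *ᵥ ξ) ⬝ᵥ η = (M *ᵥ η) ⬝ᵥ ξ := by
  rw [dotProduct_comm, Matrix.dotProduct_mulVec, ← Matrix.mulVec_transpose, hM.eq]

/-- Polarisation: positivity at `ξ + η` and `ξ - η`. Ellipticity bounds only the quadratic form, and
this passes the bound to the mixed terms for integrability. -/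
theorem abs_mulVec_dotProduct_le {d : ℕ} {M : Matrix (Fin d) (Fin d) ℝ} (hM : M.IsSymm)
    (hpos : ∀ ξ : E d, 0 ≤ (M *ᵥ ξ.ofLp) ⬝ᵥ ξ.ofLp) (ξ η : E d) :
    |(M *ᵥ ξ.ofLp) ⬝ᵥ η.ofLp|
      ≤ (M *ᵥ ξ.ofLp) ⬝ᵥ ξ.ofLp + (M *ᵥ η.ofLp) ⬝ᵥ η.ofLp := by
  have h1 := hpos (ξ + η)
  have h2 := hpos (ξ - η)
  have h3 := mulVec_dotProduct_comm hM ξ.ofLp η.ofLp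
  simp only [WithLp.ofLp_add, WithLp.ofLp_sub, Matrix.mulVec_add, Matrix.mulVec_sub, add_dotProduct,
    sub_dotProduct, dotProduct_add, dotProduct_sub] at h1 h2
  have h4 := hpos ξ
  have h5 := hpos η
  rw [abs_le]
  constructor <;> linarith

/-! ### Integrability and bilinearity of the forms. -/

namespace Admissible

variable {d : ℕ} {Ω Ω' : Opens (E d)} {A : E d → Matrix (Fin d) (Fin d) ℝ} {b : E d → E d}
  {c cp : E d → ℝ}

theorem mono (h : Admissible Ω A b c cp) (hΩ : Ω' ≤ Ω) : Admissible Ω' A b c cp where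
  A_meas i j := (h.A_meas i j).mono_measure (vol_mono hΩ)
  A_symm x hx := h.A_symm x (hΩ hx)
  A_bounds := h.A_bounds.imp fun _ ha x hx => ha x (hΩ hx)
  b_mem := h.b_mem.mono_measure (vol_mono hΩ)
  c_mem := h.c_mem.mono_measure (vol_mono hΩ)
  cp_mem := h.cp_mem.mono_measure (vol_mono hΩ)
  cp_nonneg x hx := h.cp_nonneg x (hΩ hx)

/-- The energy form is the case of `bForm` without convection and with reaction `cp`, so
integrability and bilinearity are proved once for both. -/
theorem energy (h : Admissible Ω A b c cp) : Admissible Ω A 0 cp cp where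
  A_meas := h.A_meas
  A_symm := h.A_symm
  A_bounds := h.A_bounds
  b_mem := MemLp.zero
  c_mem := h.cp_mem
  cp_mem := h.cp_mem
  cp_nonneg := h.cp_nonneg

theorem norm_sq_le (h : Admissible Ω A b c cp) {x : E d} (hx : x ∈ Ω) (ξ : E d) :
    ‖ξ‖ ^ 2 ≤ (A x *ᵥ ξ.ofLp) ⬝ᵥ ξ.ofLp := by
  obtain ⟨a, ha⟩ := h.A_bounds
  exact (ha x hx ξ).1

theorem integrable_diffusion (h : Admissible Ω A b c cp) (u v : Pair Ω) :
    Integrable (fun x => (A x *ᵥ (u.2 x).ofLp) ⬝ᵥ (v.2 x).ofLp) (vol Ω) := by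
  obtain ⟨a, ha⟩ := h.A_bounds
  have hu := ((Lp.memLp u.2).integrable_norm_pow two_ne_zero).const_mul a
  have hv := ((Lp.memLp v.2).integrable_norm_pow two_ne_zero).const_mul a
  refine (hu.add hv).mono' ?_ ?_
  · simp only [dotProduct, Matrix.mulVec]
    refine Finset.aestronglyMeasurable_fun_sum _ fun i _ => ?_
    refine AEStronglyMeasurable.mul ?_ (memLp_coord v.2 i).1
    exact Finset.aestronglyMeasurable_fun_sum _ fun j _ =>
      (h.A_meas i j).mul (memLp_coord u.2 j).1
  · filter_upwards [ae_mem Ω] with x hx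
    rw [Real.norm_eq_abs]
    exact (abs_mulVec_dotProduct_le (h.A_symm x hx)
      (fun ξ => (sq_nonneg _).trans (h.norm_sq_le hx ξ)) _ _).trans
      (add_le_add (ha x hx _).2 (ha x hx _).2)

theorem integrable_bForm (h : Admissible Ω A b c cp) (u v : Pair Ω) :
    Integrable (fun x => (A x *ᵥ (u.2 x).ofLp) ⬝ᵥ (v.2 x).ofLp
      + inner ℝ (b x) (u.2 x) * v.1 x + c x * u.1 x * v.1 x) (vol Ω) := by
  refine ((h.integrable_diffusion u v).add ?_).add ?_
  · refine ((integrable_norm_mul_norm u.2 v.1).const_mul (linfNorm Ω b)).mono'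
      ((h.b_mem.1.inner (Lp.memLp u.2).1).mul (Lp.memLp v.1).1) ?_
    filter_upwards [ae_norm_le_linfNorm h.b_mem] with x hx
    rw [norm_mul, ← mul_assoc]
    gcongr
    exact (norm_inner_le_norm _ _).trans (by gcongr)
  · refine ((integrable_norm_mul_norm u.1 v.1).const_mul (linfNorm Ω c)).mono'
      ((h.c_mem.1.mul (Lp.memLp u.1).1).mul (Lp.memLp v.1).1) ?_
    filter_upwards [ae_norm_le_linfNorm h.c_mem] with x hx
    rw [norm_mul, norm_mul, ← mul_assoc]
    gcongr

/-- The bilinear form `b_Ω` as a bilinear map. -/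
def bilin (h : Admissible Ω A b c cp) : Pair Ω →ₗ[ℝ] Pair Ω →ₗ[ℝ] ℝ :=
  LinearMap.mk₂ ℝ (bForm A b c Ω)
    (by
      intro u u' v
      refine Eq.trans (integral_congr_ae ?_)
        (integral_add (h.integrable_bForm u v) (h.integrable_bForm u' v))
      filter_upwards [Lp.coeFn_add u.1 u'.1, Lp.coeFn_add u.2 u'.2] with x h1 h2
      simp only [Prod.fst_add, Prod.snd_add, h1, h2, Pi.add_apply, WithLp.ofLp_add,
        Matrix.mulVec_add, add_dotProduct, inner_add_right]
      ring)
    (by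
      intro r u v
      refine Eq.trans (integral_congr_ae ?_) (integral_const_mul r _)
      filter_upwards [Lp.coeFn_smul r u.1, Lp.coeFn_smul r u.2] with x h1 h2
      simp only [Prod.smul_fst, Prod.smul_snd, h1, h2, Pi.smul_apply, WithLp.ofLp_smul,
        Matrix.mulVec_smul, smul_dotProduct, real_inner_smul_right, smul_eq_mul]
      ring)
    (by
      intro u v v'
      refine Eq.trans (integral_congr_ae ?_)
        (integral_add (h.integrable_bForm u v) (h.integrable_bForm u v'))
      filter_upwards [Lp.coeFn_add v.1 v'.1, Lp.coeFn_add v.2 v'.2] with x h1 h2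
      simp only [Prod.fst_add, Prod.snd_add, h1, h2, Pi.add_apply, WithLp.ofLp_add, dotProduct_add]
      ring)
    (by
      intro r u v
      refine Eq.trans (integral_congr_ae ?_) (integral_const_mul r _)
      filter_upwards [Lp.coeFn_smul r v.1, Lp.coeFn_smul r v.2] with x h1 h2
      simp only [Prod.smul_fst, Prod.smul_snd, h1, h2, Pi.smul_apply, WithLp.ofLp_smul,
        dotProduct_smul, smul_eq_mul]
      ring)

end Admissible

/-! ### Localisation, the energy norm, and lower and upper bounds for `b`. -/

variable {d : ℕ} {Ω Ω' : Opens (E d)} {A : E d → Matrix (Fin d) (Fin d) ℝ} {b : E d → E d}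
  {c cp : E d → ℝ}

theorem aForm_eq_bForm (A : E d → Matrix (Fin d) (Fin d) ℝ) (cp : E d → ℝ) (Ω : Opens (E d))
    (u v : Pair Ω) : aForm A cp Ω u v = bForm A 0 cp Ω u v := by
  simp [aForm, bForm]

/-- The integrand is linear in the second argument and its gradient, so it vanishes where both are
extended by zero. -/
theorem bForm_zeroExt (hΩ : Ω' ≤ Ω) (u : Pair Ω) (v : Pair Ω') :
    bForm A b c Ω u (zeroExt hΩ v) = bForm A b c Ω' (restrict hΩ u) v := by
  have hm : MeasurableSet (Ω' : Set (E d)) := Ω'.isOpen.measurableSet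
  have e1 : bForm A b c Ω u (zeroExt hΩ v) = ∫ x in (Ω : Set (E d)),
      (Ω' : Set (E d)).indicator (fun x => (A x *ᵥ (u.2 x).ofLp) ⬝ᵥ (v.2 x).ofLp
        + inner ℝ (b x) (u.2 x) * v.1 x + c x * u.1 x * v.1 x) x := by
    refine integral_congr_ae ?_
    filter_upwards [(memLp_indicator hΩ v.1).coeFn_toLp, (memLp_indicator hΩ v.2).coeFn_toLp]
      with x h1 h2
    simp only [zeroExt, h1, h2]
    by_cases hx : x ∈ (Ω' : Set (E d)) <;> simp [hx]
  rw [e1, setIntegral_indicator hm, Set.inter_eq_right.mpr (show (Ω' : Set (E d)) ⊆ Ω from hΩ)]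
  refine integral_congr_ae ?_
  filter_upwards [((Lp.memLp u.1).mono_measure (vol_mono hΩ)).coeFn_toLp,
    ((Lp.memLp u.2).mono_measure (vol_mono hΩ)).coeFn_toLp] with x h1 h2
  simp only [restrict, restrictLp, LinearMap.prodMap_apply, LinearMap.coe_mk, AddHom.coe_mk, h1, h2]

namespace Admissible

theorem integrable_aForm (h : Admissible Ω A b c cp) (u v : Pair Ω) :
    Integrable (fun x => (A x *ᵥ (u.2 x).ofLp) ⬝ᵥ (v.2 x).ofLp + cp x * u.1 x * v.1 x)
      (vol Ω) := by
  simpa using h.energy.integrable_bForm u v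

theorem norm_snd_sq_le_aForm (h : Admissible Ω A b c cp) (u : Pair Ω) :
    ‖u.2‖ ^ 2 ≤ aForm A cp Ω u u := by
  rw [norm_sq_eq_integral]
  refine integral_mono_ae ((Lp.memLp u.2).integrable_norm_pow two_ne_zero)
    (h.integrable_aForm u u) ?_
  filter_upwards [ae_mem Ω] with x hx
  have h1 := h.norm_sq_le hx (u.2 x)
  have h2 := mul_nonneg (h.cp_nonneg x hx) (mul_self_nonneg (u.1 x))
  linarith

theorem aForm_nonneg (h : Admissible Ω A b c cp) (u : Pair Ω) : 0 ≤ aForm A cp Ω u u :=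
  (sq_nonneg _).trans (h.norm_snd_sq_le_aForm u)

theorem sq_aNorm (h : Admissible Ω A b c cp) (u : Pair Ω) :
    aNorm A cp Ω u ^ 2 = aForm A cp Ω u u :=
  Real.sq_sqrt (h.aForm_nonneg u)

theorem norm_snd_le_aNorm (h : Admissible Ω A b c cp) (u : Pair Ω) :
    ‖u.2‖ ≤ aNorm A cp Ω u :=
  Real.le_sqrt_of_sq_le (h.norm_snd_sq_le_aForm u)

theorem aForm_comm (h : Admissible Ω A b c cp) (u v : Pair Ω) :
    aForm A cp Ω u v = aForm A cp Ω v u := by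
  refine integral_congr_ae ?_
  filter_upwards [ae_mem Ω] with x hx
  rw [mulVec_dotProduct_comm (h.A_symm x hx)]
  ring

/-- Cauchy–Schwarz for a positive semidefinite form; symmetry of `A` identifies the two mixed terms.
-/
theorem aForm_le_mul (h : Admissible Ω A b c cp) (u v : Pair Ω) :
    aForm A cp Ω u v ≤ aNorm A cp Ω u * aNorm A cp Ω v := by
  have hB : ∀ u v, h.energy.bilin u v = aForm A cp Ω u v := fun u v =>
    (aForm_eq_bForm A cp Ω u v).symm
  have := LinearMap.BilinForm.apply_mul_apply_le_of_forall_zero_le h.energy.bilin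
    (fun u => (h.aForm_nonneg u).trans_eq (hB u u).symm) u v
  simp only [hB] at this
  rw [h.aForm_comm v u, ← h.sq_aNorm, ← h.sq_aNorm, ← mul_pow, ← sq] at this
  exact le_of_sq_le_sq this (mul_nonneg (Real.sqrt_nonneg _) (Real.sqrt_nonneg _))

/-- The Gårding inequality. -/
theorem garding (h : Admissible Ω A b c cp) {β γ : ℝ} (hβ : ∀ᵐ x ∂vol Ω, ‖b x‖ ≤ β)
    (hγ : ∀ᵐ x ∂vol Ω, -γ ≤ c x - cp x) (v : Pair Ω) :
    1 / 2 * aForm A cp Ω v v - (1 / 2 * β ^ 2 + γ) * ‖v.1‖ ^ 2 ≤ bForm A b c Ω v v := by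
  have hi := ((Lp.memLp v.1).integrable_norm_pow two_ne_zero).const_mul (1 / 2 * β ^ 2 + γ)
  have ha := (h.integrable_aForm v v).const_mul (1 / 2)
  rw [norm_sq_eq_integral, ← integral_const_mul, aForm, ← integral_const_mul,
    ← integral_sub ha hi]
  refine integral_mono_ae (ha.sub hi) (h.integrable_bForm v v) ?_
  filter_upwards [ae_mem Ω, hβ, hγ] with x hx hb hc
  have h1 := h.norm_sq_le hx (v.2 x)
  have h2 := mul_nonneg (h.cp_nonneg x hx) (sq_nonneg (v.1 x))
  have h3 : -(β * ‖v.2 x‖ * ‖v.1 x‖) ≤ inner ℝ (b x) (v.2 x) * v.1 x := by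
    refine (abs_le.mp (?_ : |inner ℝ (b x) (v.2 x) * v.1 x| ≤ _)).1
    rw [abs_mul, ← Real.norm_eq_abs (v.1 x)]
    gcongr
    exact (abs_real_inner_le_norm _ _).trans (by gcongr)
  have h4 := mul_le_mul_of_nonneg_right hc (sq_nonneg (v.1 x))
  -- Young's inequality: convection costs half of `‖∇v‖ ^ 2`, which ellipticity pays from half of
  -- the diffusion term.
  have h5 := sq_nonneg (‖v.2 x‖ - β * ‖v.1 x‖)
  have h6 : ‖v.1 x‖ ^ 2 = v.1 x ^ 2 := by rw [Real.norm_eq_abs, sq_abs]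
  simp only [h6]
  nlinarith

/-- Writing `c = cp + (c - cp)`, the form is `aForm` plus two lower-order terms, each bounded by
Cauchy–Schwarz. The convection derivative stays on `u`, so `v` enters these terms only through its
`L²` norm. -/
theorem bForm_le (h : Admissible Ω A b c cp) {β δ : ℝ} (hβ0 : 0 ≤ β) (hδ0 : 0 ≤ δ)
    (hβ : ∀ᵐ x ∂vol Ω, ‖b x‖ ≤ β) (hδ : ∀ᵐ x ∂vol Ω, ‖c x - cp x‖ ≤ δ) (u v : Pair Ω) :
    bForm A b c Ω u v ≤ aNorm A cp Ω u * aNorm A cp Ω v + β * (aNorm A cp Ω u * ‖v.1‖)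
      + δ * (‖u.1‖ * ‖v.1‖) := by
  have hi := (integrable_norm_mul_norm u.2 v.1).const_mul β
  have hj := (integrable_norm_mul_norm u.1 v.1).const_mul δ
  have ha := h.integrable_aForm u v
  have hai : Integrable (fun x => (A x *ᵥ (u.2 x).ofLp) ⬝ᵥ (v.2 x).ofLp + cp x * u.1 x * v.1 x
      + β * (‖u.2 x‖ * ‖v.1 x‖)) (vol Ω) := ha.add hi
  have key : bForm A b c Ω u v ≤ aForm A cp Ω u v + β * (∫ x, ‖u.2 x‖ * ‖v.1 x‖ ∂vol Ω)
      + δ * ∫ x, ‖u.1 x‖ * ‖v.1 x‖ ∂vol Ω := by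
    rw [← integral_const_mul, ← integral_const_mul, aForm, ← integral_add ha hi,
      ← integral_add hai hj]
    refine integral_mono_ae (h.integrable_bForm u v) (hai.add hj) ?_
    filter_upwards [hβ, hδ] with x hb hc
    have h3 : inner ℝ (b x) (u.2 x) * v.1 x ≤ β * (‖u.2 x‖ * ‖v.1 x‖) := by
      refine (le_abs_self _).trans ?_
      rw [abs_mul, ← Real.norm_eq_abs (v.1 x), ← mul_assoc]
      gcongr
      exact (abs_real_inner_le_norm _ _).trans (by gcongr)
    have h4 : (c x - cp x) * (u.1 x * v.1 x) ≤ δ * (‖u.1 x‖ * ‖v.1 x‖) := by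
      refine (Real.le_norm_self _).trans ?_
      rw [norm_mul, norm_mul]
      gcongr
    linarith
  refine key.trans (add_le_add (add_le_add (h.aForm_le_mul u v) ?_) ?_)
  · exact mul_le_mul_of_nonneg_left ((integral_norm_mul_norm_le u.2 v.1).trans
      (mul_le_mul_of_nonneg_right (h.norm_snd_le_aNorm u) (norm_nonneg _))) hβ0
  · exact mul_le_mul_of_nonneg_left (integral_norm_mul_norm_le u.1 v.1) hδ0

end Admissible

/-! ### Local problems: coercivity, solvability, stability. -/

/-- Coercivity of `b_{Ω'}` on `H¹₀(Ω')` for subdomains of small diameter. -/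
theorem Admissible.coercive (h : Admissible Ω A b c cp) (hΩ : Ω' ≤ Ω) (hd : 1 ≤ d)
    (hb : Bornology.IsBounded (Ω' : Set (E d))) {H : ℝ}
    (hdiam : Metric.diam (Ω' : Set (E d)) ≤ H) (hres : H * C0 Ω b (c - cp) < 1 / 4)
    {v : Pair Ω'} (hv : v ∈ H10 Ω') :
    15 / 32 * aNorm A cp Ω' v ^ 2 ≤ bForm A b c Ω' v v := by
  have h' := h.mono hΩ
  set γ := max (-(essInf (c - cp) (vol Ω))) 0 with hγ
  set β := linfNorm Ω b with hβ
  have hH : 0 ≤ H := Metric.diam_nonneg.trans hdiam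
  have hC : C0 Ω b (c - cp) ^ 2 = 1 / 2 * β ^ 2 + γ :=
    Real.sq_sqrt (add_nonneg (by positivity) (le_max_right _ _))
  have hγ' : ∀ᵐ x ∂vol Ω', -γ ≤ c x - cp x := by
    filter_upwards [ae_mono (vol_mono hΩ) (ae_essInf_le_of_memLp_top (h.c_mem.sub h.cp_mem))]
      with x hx
    exact (neg_le.mp (le_max_left _ _)).trans hx
  have hG := h'.garding (ae_mono (vol_mono hΩ) (ae_norm_le_linfNorm h.b_mem)) hγ' v
  rw [← hβ, ← hC, ← h'.sq_aNorm] at hG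
  have hF := (norm_sq_le_of_mem_H10 hd hb hdiam hv).trans (mul_le_mul_of_nonneg_left
    ((h'.norm_snd_sq_le_aForm v).trans_eq (h'.sq_aNorm v).symm) (by positivity))
  -- Friedrichs contributes a further factor 1/2, so the loss is 1/32 and `1/2 - 1/32 = 15/32`
  -- remains.
  have hHC : (H * C0 Ω b (c - cp)) ^ 2 ≤ (1 / 4) ^ 2 :=
    pow_le_pow_left₀ (mul_nonneg hH (Real.sqrt_nonneg _)) hres.le 2
  have h1 := mul_le_mul_of_nonneg_left hF (sq_nonneg (C0 Ω b (c - cp)))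
  have h2 := mul_le_mul_of_nonneg_right hHC (sq_nonneg (aNorm A cp Ω' v))
  linarith

theorem surjective_of_injective_dual {W : Type*} [AddCommGroup W] [Module ℝ W]
    [FiniteDimensional ℝ W] (B : W →ₗ[ℝ] Module.Dual ℝ W) (hB : Function.Injective B) :
    Function.Surjective B :=
  (LinearMap.injective_iff_surjective_of_finrank_eq_finrank Subspace.dual_finrank_eq.symm).mp hB

/-- Unique solvability of the local problems. -/
theorem Admissible.existsUnique_isLocalProj (h : Admissible Ω A b c cp) (hΩ : Ω' ≤ Ω) (hd : 1 ≤ d)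
    (hb : Bornology.IsBounded (Ω' : Set (E d))) {H : ℝ}
    (hdiam : Metric.diam (Ω' : Set (E d)) ≤ H) (hres : H * C0 Ω b (c - cp) < 1 / 4)
    (V : Submodule ℝ (Pair Ω)) [FiniteDimensional ℝ V] (u : Pair Ω) :
    ∃! w : Pair Ω', IsLocalProj A b c hΩ V u w := by
  have h' := h.mono hΩ
  set W := localSpace hΩ V
  have : FiniteDimensional ℝ W := Submodule.finiteDimensional_of_le (inf_le_left :
    W ≤ V.map (restrict hΩ))
  set B : W →ₗ[ℝ] Module.Dual ℝ W := h'.bilin.domRestrict₁₂ W W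
  -- Coercivity kills the gradient of a kernel element, and Friedrichs then kills the function.
  have hinj : Function.Injective B := by
    rw [← LinearMap.ker_eq_bot, LinearMap.ker_eq_bot']
    intro w hw
    have hw10 : (w : Pair Ω') ∈ H10 Ω' := w.2.2
    have h0 : bForm A b c Ω' w w = 0 := LinearMap.congr_fun hw w
    have h1 := h.coercive hΩ hd hb hdiam hres hw10
    have h2 : ‖(w : Pair Ω').2‖ ^ 2 ≤ 0 := by
      refine (h'.norm_snd_sq_le_aForm w).trans ?_
      rw [← h'.sq_aNorm]
      linarith
    have h3 := norm_sq_le_of_mem_H10 hd hb le_rfl hw10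
    have h4 : ‖(w : Pair Ω').2‖ = 0 := pow_eq_zero_iff two_ne_zero |>.mp (h2.antisymm (sq_nonneg _))
    rw [h4, zero_pow two_ne_zero, mul_zero] at h3
    have h5 : ‖(w : Pair Ω').1‖ = 0 := pow_eq_zero_iff two_ne_zero |>.mp (h3.antisymm (sq_nonneg _))
    exact Subtype.ext (Prod.ext (norm_eq_zero.mp h5) (norm_eq_zero.mp h4))
  have hsurj := surjective_of_injective_dual B hinj
  obtain ⟨w, hw⟩ := hsurj ((h'.bilin (restrict hΩ u)).domRestrict W)
  refine ⟨w, ⟨w.2, fun v hv => ?_⟩, fun w' hw' => ?_⟩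
  · rw [bForm_zeroExt]
    exact LinearMap.congr_fun hw ⟨v, hv⟩
  · refine congrArg Subtype.val (hinj (a₁ := ⟨w', hw'.1⟩) ?_)
    rw [hw]
    ext v
    exact (hw'.2 v v.2).trans (bForm_zeroExt hΩ u v)

/-- Stability of the local projections. -/
theorem Admissible.aNorm_le_of_isLocalProj (h : Admissible Ω A b c cp) (hΩ : Ω' ≤ Ω) (hd : 1 ≤ d)
    (hb : Bornology.IsBounded (Ω' : Set (E d))) {H : ℝ}
    (hdiam : Metric.diam (Ω' : Set (E d)) ≤ H) (hres : H * C0 Ω b (c - cp) < 1 / 4)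
    {V : Submodule ℝ (Pair Ω)} {u : Pair Ω} {w : Pair Ω'} (hw : IsLocalProj A b c hΩ V u w) :
    aNorm A cp Ω' w ≤ 2 * Real.sqrt 2 * aNorm A cp Ω' (restrict hΩ u)
      + 2 * Real.sqrt (2 / 3) * H * linfNorm Ω' (c - cp) * ‖(restrict hΩ u).1‖ := by
  have h' := h.mono hΩ
  have hH : 0 ≤ H := Metric.diam_nonneg.trans hdiam
  have hw10 : w ∈ H10 Ω' := hw.1.2
  have hco := h.coercive hΩ hd hb hdiam hres hw10
  rw [hw.2 w hw.1, bForm_zeroExt] at hco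
  have hup := hco.trans (h'.bForm_le (linfNorm_nonneg Ω b) (linfNorm_nonneg Ω' (c - cp))
    (ae_mono (vol_mono hΩ) (ae_norm_le_linfNorm h.b_mem))
    (ae_norm_le_linfNorm (h'.c_mem.sub h'.cp_mem)) (restrict hΩ u) w)
  set X := aNorm A cp Ω' w
  set U := aNorm A cp Ω' (restrict hΩ u)
  set δ := linfNorm Ω' (c - cp)
  set β := linfNorm Ω b
  set n := ‖(restrict hΩ u).1‖
  have hX : 0 ≤ X := Real.sqrt_nonneg _
  have hU : 0 ≤ U := Real.sqrt_nonneg _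
  have hδ : 0 ≤ δ := linfNorm_nonneg _ _
  have hβ0 : 0 ≤ β := linfNorm_nonneg _ _
  have hn : 0 ≤ n := norm_nonneg _
  have hF : ‖w.1‖ ^ 2 ≤ H ^ 2 / 2 * X ^ 2 :=
    (norm_sq_le_of_mem_H10 hd hb hdiam hw10).trans (mul_le_mul_of_nonneg_left
      (pow_le_pow_left₀ (norm_nonneg _) (h'.norm_snd_le_aNorm w) 2) (by positivity))
  have hFβ : β * ‖w.1‖ ≤ 1 / 4 * X := by
    have hC : 1 / 2 * β ^ 2 ≤ C0 Ω b (c - cp) ^ 2 := by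
      rw [C0, Real.sq_sqrt (add_nonneg (by positivity) (le_max_right _ _))]
      exact le_add_of_nonneg_right (le_max_right _ _)
    have hHC : (H * C0 Ω b (c - cp)) ^ 2 ≤ (1 / 4) ^ 2 :=
      pow_le_pow_left₀ (mul_nonneg hH (Real.sqrt_nonneg _)) hres.le 2
    refine le_of_sq_le_sq ?_ (by positivity)
    calc (β * ‖w.1‖) ^ 2 = β ^ 2 * ‖w.1‖ ^ 2 := by ring
      _ ≤ β ^ 2 * (H ^ 2 / 2 * X ^ 2) := by gcongr
      _ = H ^ 2 * (1 / 2 * β ^ 2) * X ^ 2 := by ring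
      _ ≤ H ^ 2 * C0 Ω b (c - cp) ^ 2 * X ^ 2 := by gcongr
      _ = (H * C0 Ω b (c - cp)) ^ 2 * X ^ 2 := by ring
      _ ≤ (1 / 4) ^ 2 * X ^ 2 := by gcongr
      _ = (1 / 4 * X) ^ 2 := by ring
  -- Friedrichs gives the smaller factor `1 / √2`. The weaker one is chosen because multiplying by
  -- 32/15, the inverse coercivity constant, yields exactly `2 * √(2/3)`.
  have hF' : ‖w.1‖ ≤ 15 / 16 * Real.sqrt (2 / 3) * H * X := by
    refine le_of_sq_le_sq (hF.trans ?_) (by positivity)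
    have : (15 / 16 * Real.sqrt (2 / 3) * H * X) ^ 2
        = (15 / 16) ^ 2 * Real.sqrt (2 / 3) ^ 2 * (H ^ 2 * X ^ 2) := by ring
    rw [this, Real.sq_sqrt (by norm_num)]
    nlinarith [mul_nonneg (sq_nonneg H) (sq_nonneg X)]
  -- The coefficient of `U` is `(1 + 1/4) * 32/15 = 8/3`, which must not exceed `2 * √2`.
  have hs2 : 4 / 3 ≤ Real.sqrt 2 := Real.le_sqrt_of_sq_le (by norm_num)
  have hkey : X * X ≤ (2 * Real.sqrt 2 * U + 2 * Real.sqrt (2 / 3) * H * δ * n) * X := by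
    have e1 := mul_le_mul_of_nonneg_left hFβ hU
    have e2 := mul_le_mul_of_nonneg_left hF' (mul_nonneg hδ hn)
    have e3 := mul_le_mul_of_nonneg_right hs2 (mul_nonneg hU hX)
    linarith
  rcases hX.eq_or_lt with h0 | h0
  · rw [← h0]
    positivity
  · exact le_of_mul_le_mul_right hkey h0

end Schwarz

end

theorem mainTheorem7 {d : ℕ} (hd : 1 ≤ d)
    (Ω : TopologicalSpace.Opens (Schwarz.E d)) (hΩ : Bornology.IsBounded (Ω : Set (Schwarz.E d)))
    (A : Schwarz.E d → Matrix (Fin d) (Fin d) ℝ) (b : Schwarz.E d → Schwarz.E d)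
    (c cp : Schwarz.E d → ℝ) (hcoeff : Schwarz.Admissible Ω A b c cp)
    (V : Submodule ℝ (Schwarz.Pair Ω)) (hV : V ≤ Schwarz.H10 Ω) (hfin : FiniteDimensional ℝ V)
    {N : ℕ} (Ωs : Fin N → TopologicalSpace.Opens (Schwarz.E d)) (hΩs : ∀ i, Ωs i ≤ Ω)
    (H : ℝ) (hH : H = ⨆ i, Metric.diam (Ωs i : Set (Schwarz.E d)))
    (hres : H * Schwarz.C0 Ω b (c - cp) < 1 / 4) :
    ∀ u ∈ V, ∀ i : Fin N,
      (∃! w : Schwarz.Pair (Ωs i), Schwarz.IsLocalProj A b c (hΩs i) V u w) ∧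
      ∀ w : Schwarz.Pair (Ωs i), Schwarz.IsLocalProj A b c (hΩs i) V u w →
        Schwarz.aNorm A cp (Ωs i) w
          ≤ 2 * Real.sqrt 2 * Schwarz.aNorm A cp (Ωs i) (Schwarz.restrict (hΩs i) u)
            + 2 * Real.sqrt (2 / 3) * H * Schwarz.linfNorm (Ωs i) (c - cp)
              * ‖(Schwarz.restrict (hΩs i) u).1‖ := by
  intro u _ i
  have hb : Bornology.IsBounded (Ωs i : Set (Schwarz.E d)) := hΩ.subset (hΩs i)
  have hdiam : Metric.diam (Ωs i : Set (Schwarz.E d)) ≤ H :=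
    by
    rw [hH]
    -- A real supremum dominates its terms only for a family bounded above; here the index set is
    -- finite.
    exact le_ciSup (f := fun i => Metric.diam (Ωs i : Set (Schwarz.E d)))
      (Set.finite_range _).bddAbove i
  exact ⟨hcoeff.existsUnique_isLocalProj (hΩs i) hd hb hdiam hres V u,
    fun w hw => hcoeff.aNorm_le_of_isLocalProj (hΩs i) hd hb hdiam hres hw⟩
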